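/- **Setting.** Let $a,b,c,d,s\ge 0$ be integers with $s\le 2^a$. Let $\Sigma=[2^a]$ and $R=[2^b]$ (so $m=s2^b$ and $R=[m/s]$), both viewed as sets of bit strings with bitwise XOR $\oplus$; $\oplus$ acts on $\Sigma^d$ coordinatewise, and signs in $\{-1,1\}$ are multiplied. Keys are the elements of $\Sigma^c$, so $u=|\Sigma|^c$, and $[s]\subseteq\Sigma$. For tables $T_0,\dots,T_{n-1}$ on $\Sigma$ defining the simple tabulation function $f(x)=\bigoplus_{l\in[n]}T_l[x_l]$ and $I\subseteq[n]$ put $f_I(x)=\bigoplus_{l\in I}T_l[x_l]$ (for sign functions, the product); $I^c$ is the complement of $I$. Let $h_1\colon\Sigma^c\to R$, $\sigma_1\colon\Sigma^c\to\{-1,1\}$, $h_2\colon\Sigma^c\to\Sigma^d$, $h_3\colon\Sigma^d\to R$, $\sigma_3\colon\Sigma^d\to\{-1,1\}$ be independent simple tabulation functions with fully random tables, and let $$h(i,x)=h_1(x)\oplus h_3\big(h_2(x)\oplus i^{\otimes d}\big),\qquad \sigma(i,x)=\sigma_1(x)\,\sigma_3\big(h_2(x)\oplus i^{\otimes d}\big)\qquad(i\in[s]),$$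 where $i^{\otimes k}=(i,\dots,i)\in\Sigma^k$. Let $\overline{h_1},\overline{\sigma_1},\overline{h_2},\overline{h_3},\overline{\sigma_3}$ be built from an independent copy of all the tables. For $K\subseteq[d]$ let $f^{K}$ be the restriction of a $\Sigma^d$-valued function $f$ to the coordinates in $K$. For $I\subseteq[c]$ and $r\in[d]$ define $$h_{I,r}(i,x)=\Big(h_{1,I}(x)\oplus h_{3,\{r\}}\big(h_{2,I}^{\{r\}}(x)\oplus i\oplus h_{2,I^c}^{\{r\}}(x)\big)\Big)\oplus\Big(h_{1,I^c}(x)\oplus h_{3,\{r\}^c}\big(h_2^{\{r\}^c}(x)\oplus i^{\otimes(d-1)}\big)\Big),$$ $$\overline{h_{I,r}}(i,y)=\Big(\overline{h_{1,I}}(y)\oplus \overline{h_{3,\{r\}}}\big(\overline{h_{2,I}^{\{r\}}}(y)\oplus i\oplus h_{2,I^c}^{\{r\}}(y)\big)\Big)\oplus\Big(h_{1,I^c}(y)\oplus h_{3,\{r\}^c}\big(h_2^{\{r\}^c}(y)\oplus i^{\otimes(d-1)}\big)\Big),$$ and define $\sigma_{I,r}$ and $\overline{\sigma_{I,r}}$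 by the same formulas, with the outer $h_1,h_3,\overline{h_1},\overline{h_3}$ replaced by $\sigma_1,\sigma_3,\overline{\sigma_1},\overline{\sigma_3}$ (the inner $h_2,\overline{h_2}$ are kept) and the outer $\oplus$ replaced by multiplication. Let $P_{partial}$ be the set of all $\pi=\{(l,\alpha_l)\}_{l\in I_\pi}$ with $I_\pi\subseteq[c]$ and $\alpha_l\in\Sigma$ (including $\pi=\emptyset$). Let $P_{prefix}$ be the set of all $\tau=(\tau_0,\dots,\tau_{r-1})\in\Sigma^r$ with $0\le r<d$, and write $|\tau|=r$. Write $\pi\subseteq x$ if $x_l=\alpha_l$ for all $l\in I_\pi$, and $\tau\subseteq z$ if $\tau$ is a prefix of $z\in\Sigma^d$. Define the random sets $U_{\pi,\tau}=\{x\in\Sigma^c:\pi\subseteq x,\ \tau\subseteq h_2(x)\}$, and let $\|X\|_p=\mathbb E[|X|^p]^{1/p}$. **Lemma.** Let $p\ge 1$ be real and $w\in\mathbb R^{\Sigma^c}$. For each of the two choices $J_\pi=[c]\setminus I_\pi$ and $J_\pi=I_\pi$ (the same choice for all $\pi$), $$\Big\|\sum_{i\in[s]}\sum_{x,y\in\Sigma^c}\mathbf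 1[h_2(x)\ne h_2(y)]\,\sigma(i,x)\sigma(i,y)\mathbf 1[h(i,x)=h(i,y)]\,w_xw_y\Big\|_p$$ $$\le\sum_{\pi\in P_{partial}}\sum_{\tau\in P_{prefix}}4^{c+1}\Big\|\sum_{i\in[s]}\sum_{x,y\in U_{\pi,\tau}}\sigma_{J_\pi,|\tau|}(i,x)\,\overline{\sigma_{J_\pi,|\tau|}}(i,y)\,\mathbf 1\big[h_{J_\pi,|\tau|}(i,x)=\overline{h_{J_\pi,|\tau|}}(i,y)\big]\,w_xw_y\Big\|_p .$$ Moreover, for every realization of the tables, $$\sum_{\pi\in P_{partial}}\sum_{\tau\in P_{prefix}}\sum_{x\in U_{\pi,\tau}}w_x^2\le d\,2^c\,\|w\|_2^2 .$$ -/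

import Mathlib

open MeasureTheory ProbabilityTheory

/-- Bit strings of length `k`, identified with `[2 ^ k]`. Addition is bitwise XOR. -/
abbrev Bits (k : ℕ) : Type := Fin k → ZMod 2

/-- The binary expansion of `i`, which identifies `i < 2 ^ k` with a bit string. -/
def toBits (k i : ℕ) : Bits k := fun j => if i.testBit (j : ℕ) then 1 else 0

/-- Strings of `n` characters over the alphabet `[2 ^ a]`. The universe of keys is `Str a c`,
and the strings of derived characters are the elements of `Str a d`. -/
abbrev Str (a n : ℕ) : Type := Fin n → Bits a

/-- The lookup tables behind a mixed tabulation hash function with `c` characters and `d` derived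
characters over the alphabet `[2 ^ a]` with hash values in `[2 ^ b]`, and behind the corresponding
sign function (which uses the same derived characters). -/
structure Tables (a b c d : ℕ) where
  /-- the character tables of the simple tabulation hash function `h₁` -/
  h1 : Fin c → Bits a → Bits b
  /-- the character tables of the simple tabulation sign function `σ₁` -/
  s1 : Fin c → Bits a → ℤˣ
  /-- the character tables of the simple tabulation function `h₂` (the derived characters) -/
  h2 : Fin c → Bits a → Str a d
  /-- the character tables of the simple tabulation hash function `h₃` -/
  h3 : Fin d → Bits a → Bits b
  /-- the character tables of the simple tabulation sign function `σ₃` -/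
  s3 : Fin d → Bits a → ℤˣ

/-- Every set of tables is measurable (there are finitely many tables). -/
instance (a b c d : ℕ) : MeasurableSpace (Tables a b c d) := ⊤

/-- Simple tabulation hashing restricted to the positions in `I`: the XOR of `T l (x l)` over
`l ∈ I`. -/
def simpleTab {a n : ℕ} {M : Type} [AddCommMonoid M] (T : Fin n → Bits a → M)
    (I : Finset (Fin n)) (x : Str a n) : M :=
  ∑ l ∈ I, T l (x l)

/-- Simple tabulation sign function restricted to the positions in `I`. -/
def simpleTabSign {a n : ℕ} (T : Fin n → Bits a → ℤˣ) (I : Finset (Fin n)) (x : Str a n) : ℤˣ :=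
  ∏ l ∈ I, T l (x l)

/-- The vector `(i, …, i)` of `n` equal characters. -/
def constStr (a n i : ℕ) : Str a n := fun _ => toBits a i

/-- The derived characters `h₂(x)`. -/
def derived {a b c d : ℕ} (T : Tables a b c d) (x : Str a c) : Str a d :=
  simpleTab T.h2 Finset.univ x

/-- The mixed tabulation hash function `h(i, x) = h₁(x) ⊕ h₃(h₂(x) ⊕ (i, …, i))`. -/
def mixedHash {a b c d : ℕ} (T : Tables a b c d) (i : ℕ) (x : Str a c) : Bits b :=
  simpleTab T.h1 Finset.univ x + simpleTab T.h3 Finset.univ (derived T x + constStr a d i)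

/-- The mixed tabulation sign function `σ(i, x) = σ₁(x) σ₃(h₂(x) ⊕ (i, …, i))`. -/
def mixedSign {a b c d : ℕ} (T : Tables a b c d) (i : ℕ) (x : Str a c) : ℤˣ :=
  simpleTabSign T.s1 Finset.univ x *
    simpleTabSign T.s3 Finset.univ (derived T x + constStr a d i)

/-- The hash function that evaluates `h₁` and the derived character number `r` with the tables `A`
on the key positions in `I` and with the tables `T` on the other key positions, looks the derived
character number `r` up in the table of `A`, and does everything else with `T`.
For `A = T` this is `h_{I,r}`; for an independent copy `A` of `T` it is the copy of `h_{I,r}`. -/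
def partHash {a b c d : ℕ} (A T : Tables a b c d) (I : Finset (Fin c)) (r : Fin d) (i : ℕ)
    (x : Str a c) : Bits b :=
  (simpleTab A.h1 I x
      + simpleTab A.h3 {r} (simpleTab A.h2 I x + constStr a d i + simpleTab T.h2 Iᶜ x))
    + (simpleTab T.h1 Iᶜ x + simpleTab T.h3 {r}ᶜ (derived T x + constStr a d i))

/-- The sign function that corresponds to `partHash`. -/
def partSign {a b c d : ℕ} (A T : Tables a b c d) (I : Finset (Fin c)) (r : Fin d) (i : ℕ)
    (x : Str a c) : ℤˣ :=
  (simpleTabSign A.s1 I x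
      * simpleTabSign A.s3 {r} (simpleTab A.h2 I x + constStr a d i + simpleTab T.h2 Iᶜ x))
    * (simpleTabSign T.s1 Iᶜ x * simpleTabSign T.s3 {r}ᶜ (derived T x + constStr a d i))

/-- Partial keys `{(l, α_l)}_{l ∈ I}` with `I ⊆ [c]`, the empty one included. -/
abbrev PartialKey (a c : ℕ) : Type := (I : Finset (Fin c)) × (I → Bits a)

/-- Proper prefixes `(α_0, …, α_{r - 1})`, `0 ≤ r < d`, of strings of `d` characters, the empty one
included. -/
abbrev PrefixKey (a d : ℕ) : Type := (r : Fin d) × (Fin (r : ℕ) → Bits a)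

/-- The partial key `π` is contained in the key `x`. -/
def PartialKey.Sub {a c : ℕ} (π : PartialKey a c) (x : Str a c) : Prop :=
  ∀ l : π.1, x l = π.2 l

/-- `τ` is a prefix of `z`. -/
def PrefixKey.Sub {a d : ℕ} (τ : PrefixKey a d) (z : Str a d) : Prop :=
  ∀ k : Fin (τ.1 : ℕ), z (Fin.castLE τ.1.isLt.le k) = τ.2 k

open Classical in
/-- `U_{π,τ}`: the keys that contain `π` and whose derived characters start with `τ`. -/
noncomputable def keysU {a b c d : ℕ} (T : Tables a b c d) (π : PartialKey a c)
    (τ : PrefixKey a d) : Finset (Str a c) :=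
  Finset.univ.filter fun x => π.Sub x ∧ τ.Sub (derived T x)

/-- The `p`-norm `E[|X|^p]^{1/p}` of a random variable. -/
noncomputable def pNorm {Ω : Type*} [MeasurableSpace Ω] (μ : Measure Ω) (p : ℝ) (X : Ω → ℝ) : ℝ :=
  (∫ ω, |X ω| ^ p ∂μ) ^ (1 / p)

/-- `∑_{i ∈ [s]} ∑_{x, y} 1[h₂(x) ≠ h₂(y)] σ(i, x) σ(i, y) 1[h(i, x) = h(i, y)] w_x w_y` -/
noncomputable def collisionSum {a b c d : ℕ} (s : ℕ) (w : Str a c → ℝ) (T : Tables a b c d) : ℝ :=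
  ∑ i ∈ Finset.range s, ∑ x, ∑ y,
    (if derived T x ≠ derived T y then 1 else 0)
      * (((mixedSign T i x : ℤ) : ℝ) * ((mixedSign T i y : ℤ) : ℝ))
      * (if mixedHash T i x = mixedHash T i y then 1 else 0) * (w x * w y)

/-- The decoupled collision sum over `x, y ∈ U_{π,τ}`, in which the tables at the key positions in
`J` and the table of the derived character number `|τ|` are replaced by those of `T'` for `y`. -/
noncomputable def decoupledSum {a b c d : ℕ} (s : ℕ) (w : Str a c → ℝ) (T T' : Tables a b c d)
    (J : Finset (Fin c)) (π : PartialKey a c) (τ : PrefixKey a d) : ℝ :=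
  ∑ i ∈ Finset.range s, ∑ x ∈ keysU T π τ, ∑ y ∈ keysU T π τ,
    (((partSign T T J τ.1 i x : ℤ) : ℝ) * ((partSign T' T J τ.1 i y : ℤ) : ℝ))
      * (if partHash T T J τ.1 i x = partHash T' T J τ.1 i y then 1 else 0) * (w x * w y)

/-! Sort the pairs `(x, y)` by the partial key `π` on which they agree and by the longest common
prefix `τ` of their derived strings. Then `x` and `y` look up different entries at every key
position outside `π` and at the derived character `|τ|`, so the tables there can be decoupled while
all others stay shared.

Colour the entries of these tables by a uniform Boolean `ε`. All entries of `x` are coloured `true`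
and all those of `y` `false` with probability `4^{-(|J|+1)}`, so `distinctSum` is `4^{|J|+1}` times
the average of `splitSum` over `ε` (`card_mul_distinctSum`). For fixed `ε`, the entries read by `x`
and by `y` are disjoint; exchanging entries between `T` and `T'` preserves the uniform law and moves
`y` to `T'` (`splitSum_mixTables`). The restriction to separated pairs is removed by random signs
`δ` on the `false` entries of `T` and the `true` entries of `T'`: averaging over `δ` kills exactly
the unseparated pairs (`card_mul_splitSum`), and each sign change preserves the law. Minkowski's
inequality turns the averages into bounds.

For `J = I_π` the terms with `π = ∅` suffice: separating the derived character `|τ|` alone already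
decouples the whole sum, and the other terms are nonnegative. -/

/-! ### Norms on finite types -/

section FiniteNorm

variable {ι κ : Type*} [Fintype ι]

/-- The unnormalised `ℓ^p`-norm of a function on a finite type. -/
noncomputable def lpSum (p : ℝ) (X : ι → ℝ) : ℝ := (∑ t, |X t| ^ p) ^ (1 / p)

theorem lpSum_nonneg (p : ℝ) (X : ι → ℝ) : 0 ≤ lpSum p X := by
  unfold lpSum; positivity

theorem lpSum_sum_le {p : ℝ} (hp : 1 ≤ p) (S : Finset κ) (X : κ → ι → ℝ) :
    lpSum p (fun t => ∑ k ∈ S, X k t) ≤ ∑ k ∈ S, lpSum p (X k) := by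
  classical
  induction S using Finset.induction_on with
  | empty =>
    have h : p ≠ 0 := by linarith
    simp [lpSum, Real.zero_rpow h, Real.zero_rpow (inv_ne_zero h)]
  | insert k S hk ih =>
    simp only [Finset.sum_insert hk]
    exact (Real.Lp_add_le Finset.univ (X k) (fun t => ∑ k ∈ S, X k t) hp).trans (by
      gcongr
      · exact le_rfl
      · exact ih)

theorem lpSum_const_mul {p : ℝ} (hp : 1 ≤ p) {C : ℝ} (hC : 0 ≤ C) (X : ι → ℝ) :
    lpSum p (fun t => C * X t) = C * lpSum p X := by
  have h : p ≠ 0 := by linarith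
  unfold lpSum
  simp only [abs_mul, abs_of_nonneg hC, Real.mul_rpow hC (abs_nonneg _)]
  rw [← Finset.mul_sum, Real.mul_rpow (by positivity) (by positivity), one_div,
    Real.rpow_rpow_inv hC h]

/-- Under the uniform law, this expresses equality in distribution through a bijection of the
tables. -/
theorem lpSum_comp_equiv (p : ℝ) (e : ι ≃ ι) (X : ι → ℝ) :
    lpSum p (fun t => X (e t)) = lpSum p X := by
  unfold lpSum
  rw [e.sum_comp (fun t => |X t| ^ p)]

end FiniteNorm

/-! ### Random colourings and random signs -/

section RandomSplit

variable {κ A : Type*} [Fintype κ] [DecidableEq κ] [DecidableEq A]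

/-- The indicator that `ε` separates `u` from `v` at all positions in `S`. -/
def splitInd (S : Finset κ) (ε : κ → A → Bool) (u v : κ → A) : ℝ :=
  if ∀ k ∈ S, ε k (u k) = true ∧ ε k (v k) = false then 1 else 0

/-- The involution that toggles the value of a Boolean function at one point. -/
def toggle (u : A) : (A → Bool) ≃ (A → Bool) :=
  Function.Involutive.toPerm (fun e => Function.update e u (!e u)) (by
    intro e; ext1 a; by_cases h : a = u <;> simp [h])

theorem toggle_apply (u : A) (e : A → Bool) (a : A) :
    toggle u e a = if a = u then !e u else e a := by
  simp [toggle, Function.Involutive.toPerm, Function.update_apply]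

variable [Fintype A]

/-- Values at distinct points are independent fair bits, so a prescribed pattern has probability
1/4; toggling one point shows this by symmetry. -/
theorem four_mul_sum_bool_split (u v : A) :
    (∑ e : A → Bool, if e u = true ∧ e v = false then (1 : ℝ) else 0) * 4
      = (Fintype.card (A → Bool) : ℝ) * (if u ≠ v then 1 else 0) := by
  by_cases h : u = v
  · subst h; simp
  have h1 : (∑ e : A → Bool, if e u = true ∧ e v = false then (1 : ℝ) else 0)
      = ∑ e : A → Bool, if e u = false ∧ e v = false then (1 : ℝ) else 0 := by
    rw [← (toggle u).sum_comp]
    refine Finset.sum_congr rfl fun e _ => ?_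
    simp [toggle_apply, Ne.symm h]
  have h2 : (∑ e : A → Bool, if e v = false then (1 : ℝ) else 0)
      = ∑ e : A → Bool, if e v = true then (1 : ℝ) else 0 := by
    rw [← (toggle v).sum_comp]
    refine Finset.sum_congr rfl fun e _ => ?_
    simp [toggle_apply]
  have h3 : (∑ e : A → Bool, if e u = true ∧ e v = false then (1 : ℝ) else 0)
      + (∑ e : A → Bool, if e u = false ∧ e v = false then (1 : ℝ) else 0)
      = ∑ e : A → Bool, if e v = false then (1 : ℝ) else 0 := by
    rw [← Finset.sum_add_distrib]
    refine Finset.sum_congr rfl fun e _ => ?_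
    cases e u <;> cases e v <;> simp
  have h4 : (∑ e : A → Bool, if e v = false then (1 : ℝ) else 0)
      + (∑ e : A → Bool, if e v = true then (1 : ℝ) else 0)
      = (Fintype.card (A → Bool) : ℝ) := by
    rw [← Finset.sum_add_distrib, Fintype.card, Finset.cast_card]
    refine Finset.sum_congr rfl fun e _ => ?_
    cases e v <;> simp
  rw [if_pos h]
  linarith

theorem sum_splitInd (S : Finset κ) (u v : κ → A) :
    (∑ ε : κ → A → Bool, splitInd S ε u v) * 4 ^ S.card
      = (Fintype.card (κ → A → Bool) : ℝ) * (if ∀ k ∈ S, u k ≠ v k then 1 else 0) := by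
  have h1 : ∀ ε : κ → A → Bool, splitInd S ε u v
      = ∏ k, if k ∈ S then (if ε k (u k) = true ∧ ε k (v k) = false then (1 : ℝ) else 0)
          else 1 := by
    intro ε
    rw [Finset.prod_ite_mem, Finset.univ_inter, Finset.prod_ite_zero]
    simp [splitInd]
  have h2 : (4 : ℝ) ^ S.card = ∏ k : κ, if k ∈ S then 4 else 1 := by
    rw [Finset.prod_ite_mem, Finset.univ_inter, Finset.prod_const]
  have h3 : (if ∀ k ∈ S, u k ≠ v k then (1 : ℝ) else 0)
      = ∏ k, if k ∈ S then (if u k ≠ v k then (1 : ℝ) else 0) else 1 := by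
    rw [Finset.prod_ite_mem, Finset.univ_inter, Finset.prod_ite_zero]
    simp
  have h4 : (∑ ε : κ → A → Bool, splitInd S ε u v)
      = ∏ k, ∑ e : A → Bool,
        if k ∈ S then (if e (u k) = true ∧ e (v k) = false then (1 : ℝ) else 0) else 1 := by
    rw [Finset.prod_univ_sum, Fintype.piFinset_univ]
    exact Finset.sum_congr rfl fun ε _ => h1 ε
  have h5 : (Fintype.card (κ → A → Bool) : ℝ)
      = ∏ _k : κ, (Fintype.card (A → Bool) : ℝ) := by
    rw [Fintype.card_pi]; push_cast; rfl
  rw [h4, h2, h3, h5, ← Finset.prod_mul_distrib, ← Finset.prod_mul_distrib]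
  refine Finset.prod_congr rfl fun k _ => ?_
  by_cases hk : k ∈ S
  · simpa only [hk, if_true] using four_mul_sum_bool_split (u k) (v k)
  · simp [hk]

/-- The signs `δ` at the entries where `ε` has the value `β`. -/
def flipSign (ε : κ → A → Bool) (δ : κ → A → ℤˣ) (β : Bool) (k : κ) (α : A) : ℤˣ :=
  if ε k α = β then δ k α else 1

/-- For a separated pair no entry of `δ` is read and the product is 1. Otherwise some entry of `δ`
is read exactly once, or twice at one position through different points, and negating it flips the
product. -/
theorem sum_flipSign (S : Finset κ) (ε : κ → A → Bool) (u v : κ → A) :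
    ∑ δ : κ → A → ℤˣ, (((∏ k ∈ S, flipSign ε δ false k (u k) * flipSign ε δ true k (v k) : ℤˣ) : ℤ)
        : ℝ)
      = (Fintype.card (κ → A → ℤˣ) : ℝ) * splitInd S ε u v := by
  by_cases hS : ∀ k ∈ S, ε k (u k) = true ∧ ε k (v k) = false
  · have : ∀ δ : κ → A → ℤˣ,
        (∏ k ∈ S, flipSign ε δ false k (u k) * flipSign ε δ true k (v k)) = 1 := fun δ =>
      Finset.prod_eq_one fun k hk => by simp [flipSign, hS k hk]
    simp [this, splitInd, if_pos hS]
  · rw [splitInd, if_neg hS, mul_zero]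
    push Not at hS
    obtain ⟨k, hk, hbad⟩ := hS
    -- An entry of `δ` that is really read at the bad position `k`: `u k` if its colour is wrong,
    -- else `v k`.
    set α : A := if ε k (u k) = false then u k else v k with hα
    set e : κ → A → ℤˣ := Pi.mulSingle k (Pi.mulSingle α (-1)) with he
    have hk0 : ∀ δ : κ → A → ℤˣ,
        flipSign ε (δ * e) false k (u k) * flipSign ε (δ * e) true k (v k)
          = -(flipSign ε δ false k (u k) * flipSign ε δ true k (v k)) := by
      intro δ
      by_cases h : ε k (u k) = false
      · have hα' : α = u k := by simp [hα, h]
        by_cases hv : ε k (v k) = true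
        -- Different colours force different points, so the second factor does not see the sign
        -- change.
        · have hne : v k ≠ u k := by
            intro h'; rw [h', h] at hv; cases hv
          simp [flipSign, h, hv, he, hα', hne]
        · simp [flipSign, h, hv, he, hα']
      · have hv : ε k (v k) = true := by simpa using hbad (by simpa using h)
        have hα' : α = v k := by simp [hα, h]
        simp [flipSign, h, hv, he, hα']
    have hother : ∀ δ : κ → A → ℤˣ, ∀ k' ∈ S.erase k,
        flipSign ε (δ * e) false k' (u k') * flipSign ε (δ * e) true k' (v k')
          = flipSign ε δ false k' (u k') * flipSign ε δ true k' (v k') := by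
      intro δ k' hk'
      have hne : k' ≠ k := Finset.ne_of_mem_erase hk'
      simp [flipSign, he, hne]
    have hneg : ∀ δ : κ → A → ℤˣ,
        (∏ k ∈ S, flipSign ε (δ * e) false k (u k) * flipSign ε (δ * e) true k (v k))
          = -∏ k ∈ S, flipSign ε δ false k (u k) * flipSign ε δ true k (v k) := by
      intro δ
      rw [← Finset.mul_prod_erase _ _ hk, ← Finset.mul_prod_erase _ _ hk, hk0,
        Finset.prod_congr rfl (hother δ), neg_mul]
    have key := Equiv.sum_comp (Equiv.mulRight e) (fun δ : κ → A → ℤˣ =>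
      (((∏ k ∈ S, flipSign ε δ false k (u k) * flipSign ε δ true k (v k) : ℤˣ) : ℤ) : ℝ))
    simp only [Equiv.coe_mulRight, hneg, Units.val_neg, Int.cast_neg,
      Finset.sum_neg_distrib] at key
    linarith

end RandomSplit

/-! ### Exchanging table entries and flipping signs -/

section TableOperations

variable {a b c d : ℕ}

instance (k : ℕ) : Finite (Bits k) := inferInstance

instance (k n : ℕ) {M : Type*} [Finite M] : Finite (Fin n → Bits k → M) := inferInstance

instance : Finite (Tables a b c d) :=
  Finite.of_injective
    (β := (Fin c → Bits a → Bits b) × (Fin c → Bits a → ℤˣ) × (Fin c → Bits a → Fin d → Bits a) ×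
      (Fin d → Bits a → Bits b) × (Fin d → Bits a → ℤˣ))
    (fun T : Tables a b c d => (T.h1, T.s1, T.h2, T.h3, T.s3)) (by
      rintro ⟨_, _, _, _, _⟩ ⟨_, _, _, _, _⟩ h
      simpa using h)

noncomputable instance : Fintype (Tables a b c d) := Fintype.ofFinite _

instance : DiscreteMeasurableSpace (Tables a b c d) := ⟨fun _ => trivial⟩

instance : Nonempty (Tables a b c d) :=
  ⟨⟨fun _ _ => 0, fun _ _ => 1, fun _ _ => 0, fun _ _ => 0, fun _ _ => 1⟩⟩

/-- The table entries that `partHash A T J r i x` and `partSign A T J r i x` look up in `A`: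
position `some l` is the key position `l`, position `none` the derived character number `r`. -/
def lookupPos (A T : Tables a b c d) (J : Finset (Fin c)) (r : Fin d) (i : ℕ) (x : Str a c) :
    Option (Fin c) → Bits a
  | none => (simpleTab A.h2 J x + constStr a d i + simpleTab T.h2 Jᶜ x) r
  | some l => x l

/-- The tables that agree with `T` except at the positions in `J` and the derived character
number `r`, where the entries are those of `T` or `T'` according to `ε`. -/
def mixTables (J : Finset (Fin c)) (r : Fin d) (ε : Option (Fin c) → Bits a → Bool)
    (T T' : Tables a b c d) : Tables a b c d where
  h1 l α := if l ∈ J then (cond (ε (some l) α) T T').h1 l α else T.h1 l α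
  s1 l α := if l ∈ J then (cond (ε (some l) α) T T').s1 l α else T.s1 l α
  h2 l α k := if l ∈ J ∧ k = r then (cond (ε (some l) α) T T').h2 l α k else T.h2 l α k
  h3 k α := if k = r then (cond (ε none α) T T').h3 k α else T.h3 k α
  s3 k α := if k = r then (cond (ε none α) T T').s3 k α else T.s3 k α

theorem mixTables_mixTables (J : Finset (Fin c)) (r : Fin d)
    (ε : Option (Fin c) → Bits a → Bool) (T T' : Tables a b c d) :
    mixTables J r ε (mixTables J r ε T T') (mixTables J r ε T' T) = T := by
  rcases T with ⟨_, _, _, _, _⟩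
  simp only [mixTables, Tables.mk.injEq]
  refine ⟨?_, ?_, ?_, ?_, ?_⟩
  · ext1 l; ext1 α; cases hε : ε (some l) α <;> by_cases h : l ∈ J <;> simp [h, hε]
  · ext1 l; ext1 α; cases hε : ε (some l) α <;> by_cases h : l ∈ J <;> simp [h, hε]
  · ext1 l; ext1 α; ext1 k
    cases hε : ε (some l) α <;> by_cases h : l ∈ J ∧ k = r <;> simp [h, hε]
  · ext1 k; ext1 α; cases hε : ε none α <;> by_cases h : k = r <;> simp [h, hε]
  · ext1 k; ext1 α; cases hε : ε none α <;> by_cases h : k = r <;> simp [h, hε]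

/-- Mixing in both directions is an involution of the pairs of tables. -/
def mixEquiv (J : Finset (Fin c)) (r : Fin d) (ε : Option (Fin c) → Bits a → Bool) :
    Tables a b c d × Tables a b c d ≃ Tables a b c d × Tables a b c d :=
  Function.Involutive.toPerm
    (fun t => (mixTables J r ε t.1 t.2, mixTables J r ε t.2 t.1)) (fun t => by
      simp [mixTables_mixTables])

theorem mixEquiv_apply (J : Finset (Fin c)) (r : Fin d) (ε : Option (Fin c) → Bits a → Bool)
    (t : Tables a b c d × Tables a b c d) :
    mixEquiv J r ε t = (mixTables J r ε t.1 t.2, mixTables J r ε t.2 t.1) := rfl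

/-- The tables `T` with the signs at the positions in `J` and at the derived character number `r`
multiplied by `g`. -/
def flipTables (J : Finset (Fin c)) (r : Fin d) (g : Option (Fin c) → Bits a → ℤˣ)
    (T : Tables a b c d) : Tables a b c d where
  h1 := T.h1
  s1 l α := if l ∈ J then g (some l) α * T.s1 l α else T.s1 l α
  h2 := T.h2
  h3 := T.h3
  s3 k α := if k = r then g none α * T.s3 k α else T.s3 k α

theorem flipTables_flipTables (J : Finset (Fin c)) (r : Fin d)
    (g : Option (Fin c) → Bits a → ℤˣ) (T : Tables a b c d) :
    flipTables J r g (flipTables J r g T) = T := by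
  rcases T with ⟨_, _, _, _, _⟩
  simp only [flipTables, Tables.mk.injEq, true_and]
  constructor
  · ext1 l; ext1 α; by_cases h : l ∈ J <;> simp [h, ← mul_assoc, Int.units_mul_self]
  · ext1 k; ext1 α; by_cases h : k = r <;> simp [h, ← mul_assoc, Int.units_mul_self]

/-- Flipping signs in both components is an involution of the pairs of tables. -/
def flipEquiv (J : Finset (Fin c)) (r : Fin d) (g g' : Option (Fin c) → Bits a → ℤˣ) :
    Tables a b c d × Tables a b c d ≃ Tables a b c d × Tables a b c d :=
  Function.Involutive.toPerm
    (fun t => (flipTables J r g t.1, flipTables J r g' t.2)) (fun t => by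
      simp [flipTables_flipTables])

theorem flipEquiv_apply (J : Finset (Fin c)) (r : Fin d) (g g' : Option (Fin c) → Bits a → ℤˣ)
    (t : Tables a b c d × Tables a b c d) :
    flipEquiv J r g g' t = (flipTables J r g t.1, flipTables J r g' t.2) := rfl

/-- The tables of `h2` are not flipped, so the looked-up positions do not move; the flips of `T` are
invisible because its signs are read only outside `J` and `r`. -/
theorem partSign_flipTables (J : Finset (Fin c)) (r : Fin d)
    (g g' : Option (Fin c) → Bits a → ℤˣ) (A T : Tables a b c d) (i : ℕ) (x : Str a c) :
    partSign (flipTables J r g A) (flipTables J r g' T) J r i x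
      = (∏ k ∈ Finset.insertNone J, g k (lookupPos A T J r i x k)) * partSign A T J r i x := by
  have h1 : simpleTabSign (flipTables J r g A).s1 J x
      = (∏ l ∈ J, g (some l) (x l)) * simpleTabSign A.s1 J x := by
    rw [simpleTabSign, simpleTabSign, ← Finset.prod_mul_distrib]
    exact Finset.prod_congr rfl fun l hl => by simp [flipTables, hl]
  have h2 : simpleTabSign (flipTables J r g' T).s1 Jᶜ x = simpleTabSign T.s1 Jᶜ x :=
    Finset.prod_congr rfl fun l hl => by
      simp [flipTables, Finset.mem_compl.1 hl]
  have h3 : ∀ z : Str a d, simpleTabSign (flipTables J r g' T).s3 {r}ᶜ z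
      = simpleTabSign T.s3 {r}ᶜ z := fun z =>
    Finset.prod_congr rfl fun k hk => by
      have : k ≠ r := by simpa using hk
      simp [flipTables, this]
  have h4 : ∀ z : Str a d, simpleTabSign (flipTables J r g A).s3 {r} z
      = g none (z r) * simpleTabSign A.s3 {r} z := fun z => by
    simp [simpleTabSign, flipTables]
  unfold partSign
  rw [h1, h2, h3, h4, Finset.prod_insertNone]
  simp only [lookupPos, flipTables, derived]
  ac_rfl

theorem derived_apply (T : Tables a b c d) (x : Str a c) (k : Fin d) :
    derived T x k = ∑ l, T.h2 l (x l) k := by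
  simp [derived, simpleTab]

theorem derived_mixTables_of_ne (J : Finset (Fin c)) (r : Fin d)
    (ε : Option (Fin c) → Bits a → Bool) (T T' : Tables a b c d) (x : Str a c) {k : Fin d}
    (hk : k ≠ r) : derived (mixTables J r ε T T') x k = derived T x k := by
  simp [derived_apply, mixTables, hk]

/-- Membership depends only on derived characters before `|τ|`, whereas mixing changes only number
`|τ|`. -/
theorem keysU_mixTables (J : Finset (Fin c)) (ε : Option (Fin c) → Bits a → Bool)
    (T T' : Tables a b c d) (π : PartialKey a c) (τ : PrefixKey a d) :
    keysU (mixTables J τ.1 ε T T') π τ = keysU T π τ := by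
  ext x
  have h : ∀ k : Fin (τ.1 : ℕ),
      derived (mixTables J τ.1 ε T T') x (Fin.castLE τ.1.isLt.le k)
        = derived T x (Fin.castLE τ.1.isLt.le k) := fun k =>
    derived_mixTables_of_ne J τ.1 ε T T' x (by
      intro h
      have := congrArg Fin.val h
      have := k.isLt
      simp at *
      omega)
  classical
  unfold keysU
  rw [Finset.mem_filter, Finset.mem_filter]
  simp only [PrefixKey.Sub, h]

/-- Colours at the key positions alone fix the derived character, so the colour at `none` can be
tested afterwards without circularity. -/
theorem lookupPos_mixTables {J : Finset (Fin c)} {r : Fin d}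
    {ε : Option (Fin c) → Bits a → Bool} {T T' : Tables a b c d} {i : ℕ} {x : Str a c} {β : Bool}
    (hx : ∀ l ∈ J, ε (some l) (x l) = β) :
    lookupPos (mixTables J r ε T T') (mixTables J r ε T T') J r i x
      = lookupPos (cond β T T') T J r i x := by
  funext k
  cases k with
  | some l => rfl
  | none =>
    have h1 : simpleTab (mixTables J r ε T T').h2 J x r = simpleTab (cond β T T').h2 J x r := by
      simp only [simpleTab, Finset.sum_apply]
      exact Finset.sum_congr rfl fun l hl => by simp [mixTables, hl, hx l hl]
    have h2 : simpleTab (mixTables J r ε T T').h2 Jᶜ x r = simpleTab T.h2 Jᶜ x r := by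
      simp only [simpleTab, Finset.sum_apply]
      exact Finset.sum_congr rfl fun l hl => by simp [mixTables, Finset.mem_compl.1 hl]
    simp only [lookupPos, Pi.add_apply, h1, h2]

theorem part_mixTables {J : Finset (Fin c)} {r : Fin d}
    {ε : Option (Fin c) → Bits a → Bool} {T T' : Tables a b c d} {i : ℕ} {x : Str a c} {β : Bool}
    (hx : ∀ k ∈ Finset.insertNone J, ε k (lookupPos (cond β T T') T J r i x k) = β) :
    partHash (mixTables J r ε T T') (mixTables J r ε T T') J r i x
        = partHash (cond β T T') T J r i x ∧
      partSign (mixTables J r ε T T') (mixTables J r ε T T') J r i x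
        = partSign (cond β T T') T J r i x := by
  rw [Finset.forall_mem_insertNone] at hx
  have hJ : ∀ l ∈ J, ε (some l) (x l) = β := hx.2
  have hpos := congrFun (lookupPos_mixTables (r := r) (T := T) (T' := T') (i := i) hJ) none
  have hnone : ε none (lookupPos (cond β T T') T J r i x none) = β := hx.1
  simp only [lookupPos] at hpos hnone
  have hder : ∀ k ∈ ({r}ᶜ : Finset (Fin d)),
      (derived (mixTables J r ε T T') x + constStr a d i) k = (derived T x + constStr a d i) k :=
    fun k hk => by
      rw [Pi.add_apply, Pi.add_apply, derived_mixTables_of_ne _ _ _ _ _ _ (by simpa using hk)]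
  constructor
  · unfold partHash
    congr 2
    · exact Finset.sum_congr rfl fun l hl => by simp [mixTables, hl, hJ l hl]
    · simp only [simpleTab, Finset.sum_singleton] at hpos hnone ⊢
      rw [hpos]
      simp only [mixTables, if_true, hnone]
    · exact Finset.sum_congr rfl fun l hl => by simp [mixTables, Finset.mem_compl.1 hl]
    · refine Finset.sum_congr rfl fun k hk => ?_
      have hk' : k ≠ r := by simpa using hk
      rw [hder k hk]
      simp [mixTables, hk']
  · unfold partSign
    congr 2
    · exact Finset.prod_congr rfl fun l hl => by simp [mixTables, hl, hJ l hl]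
    · simp only [simpleTabSign, Finset.prod_singleton] at hpos hnone ⊢
      rw [hpos]
      simp only [mixTables, if_true, hnone]
    · exact Finset.prod_congr rfl fun l hl => by simp [mixTables, Finset.mem_compl.1 hl]
    · refine Finset.prod_congr rfl fun k hk => ?_
      have hk' : k ≠ r := by simpa using hk
      rw [hder k hk]
      simp [mixTables, hk']

theorem derived_split (T : Tables a b c d) (J : Finset (Fin c)) (i : ℕ) (x : Str a c) :
    simpleTab T.h2 J x + constStr a d i + simpleTab T.h2 Jᶜ x = derived T x + constStr a d i := by
  rw [derived, simpleTab, simpleTab, simpleTab, ← Finset.sum_add_sum_compl J]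
  abel

theorem lookupPos_self_none (T : Tables a b c d) (J : Finset (Fin c)) (r : Fin d) (i : ℕ)
    (x : Str a c) : lookupPos T T J r i x none = derived T x r + toBits a i := by
  simp only [lookupPos, derived_split]
  rfl

theorem partHash_self (T : Tables a b c d) (J : Finset (Fin c)) (r : Fin d) (i : ℕ)
    (x : Str a c) : partHash T T J r i x = mixedHash T i x := by
  unfold partHash mixedHash
  rw [derived_split]
  simp only [simpleTab]
  rw [← Finset.sum_add_sum_compl J, ← Finset.sum_add_sum_compl ({r} : Finset (Fin d))]
  abel

theorem partSign_self (T : Tables a b c d) (J : Finset (Fin c)) (r : Fin d) (i : ℕ)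
    (x : Str a c) : partSign T T J r i x = mixedSign T i x := by
  unfold partSign mixedSign
  rw [derived_split]
  simp only [simpleTabSign]
  rw [← Finset.prod_mul_prod_compl J, ← Finset.prod_mul_prod_compl ({r} : Finset (Fin d))]
  ac_rfl

end TableOperations

/-! ### Decoupling a single pair `(π, τ)` -/

section Decoupling

variable {a b c d : ℕ}

/-- The summand of `decoupledSum`. -/
noncomputable def decoupledTerm (w : Str a c → ℝ) (T T' : Tables a b c d) (J : Finset (Fin c))
    (r : Fin d) (i : ℕ) (x y : Str a c) : ℝ :=
  (((partSign T T J r i x : ℤ) : ℝ) * ((partSign T' T J r i y : ℤ) : ℝ))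
    * (if partHash T T J r i x = partHash T' T J r i y then 1 else 0) * (w x * w y)

/-- The part of `decoupledSum` in which the looked up entries of `T` and `T'` are separated
by `ε`. -/
noncomputable def splitSum (s : ℕ) (w : Str a c → ℝ) (T T' : Tables a b c d)
    (J : Finset (Fin c)) (π : PartialKey a c) (τ : PrefixKey a d)
    (ε : Option (Fin c) → Bits a → Bool) : ℝ :=
  ∑ i ∈ Finset.range s, ∑ x ∈ keysU T π τ, ∑ y ∈ keysU T π τ,
    splitInd (Finset.insertNone J) ε (lookupPos T T J τ.1 i x) (lookupPos T' T J τ.1 i y)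
      * decoupledTerm w T T' J τ.1 i x y

/-- The part of the collision sum over `x, y ∈ U_{π,τ}` that look up different entries at the
positions in `J` and at the derived character number `|τ|`. -/
noncomputable def distinctSum (s : ℕ) (w : Str a c → ℝ) (T : Tables a b c d)
    (J : Finset (Fin c)) (π : PartialKey a c) (τ : PrefixKey a d) : ℝ :=
  ∑ i ∈ Finset.range s, ∑ x ∈ keysU T π τ, ∑ y ∈ keysU T π τ,
    (if ∀ k ∈ Finset.insertNone J, lookupPos T T J τ.1 i x k ≠ lookupPos T T J τ.1 i y k
      then 1 else 0) * decoupledTerm w T T J τ.1 i x y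

theorem card_mul_distinctSum (s : ℕ) (w : Str a c → ℝ) (T : Tables a b c d)
    (J : Finset (Fin c)) (π : PartialKey a c) (τ : PrefixKey a d) :
    (Fintype.card (Option (Fin c) → Bits a → Bool) : ℝ) * distinctSum s w T J π τ
      = ∑ ε, 4 ^ (J.card + 1) * splitSum s w T T J π τ ε := by
  simp only [distinctSum, splitSum, Finset.mul_sum]
  symm
  rw [Finset.sum_comm]
  refine Finset.sum_congr rfl fun i _ => ?_
  rw [Finset.sum_comm]
  refine Finset.sum_congr rfl fun x _ => ?_
  rw [Finset.sum_comm]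
  refine Finset.sum_congr rfl fun y _ => ?_
  rw [← mul_assoc, ← sum_splitInd, Finset.card_insertNone, Finset.sum_mul, Finset.sum_mul]
  exact Finset.sum_congr rfl fun ε _ => by ring

theorem splitSum_mixTables (s : ℕ) (w : Str a c → ℝ) (T T' : Tables a b c d)
    (J : Finset (Fin c)) (π : PartialKey a c) (τ : PrefixKey a d)
    (ε : Option (Fin c) → Bits a → Bool) :
    splitSum s w (mixTables J τ.1 ε T T') (mixTables J τ.1 ε T T') J π τ ε
      = splitSum s w T T' J π τ ε := by
  unfold splitSum
  rw [keysU_mixTables]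
  refine Finset.sum_congr rfl fun i _ => Finset.sum_congr rfl fun x _ =>
    Finset.sum_congr rfl fun y _ => ?_
  -- This condition involves no tables. It must come first, since the derived characters of the
  -- mixed tables are known only under it; when it fails, both indicators vanish.
  by_cases hJ : (∀ l ∈ J, ε (some l) (x l) = true) ∧ ∀ l ∈ J, ε (some l) (y l) = false
  · have hu := lookupPos_mixTables (r := τ.1) (T := T) (T' := T') (i := i) hJ.1
    have hv := lookupPos_mixTables (r := τ.1) (T := T) (T' := T') (i := i) hJ.2
    rw [hu, hv]
    simp only [cond_true, cond_false]
    by_cases h : ∀ k ∈ Finset.insertNone J, ε k (lookupPos T T J τ.1 i x k) = true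
        ∧ ε k (lookupPos T' T J τ.1 i y k) = false
    · have hx := part_mixTables (β := true) (T := T) (T' := T') fun k hk => (h k hk).1
      have hy := part_mixTables (β := false) (T := T) (T' := T') fun k hk => (h k hk).2
      simp only [decoupledTerm, hx, hy, cond_true, cond_false]
    · rw [splitInd, if_neg h, zero_mul, zero_mul]
  · have h0 : ∀ u v : Option (Fin c) → Bits a, (∀ l, u (some l) = x l) → (∀ l, v (some l) = y l) →
        splitInd (Finset.insertNone J) ε u v = 0 := by
      intro u v hu hv
      refine if_neg fun h => hJ ⟨fun l hl => ?_, fun l hl => ?_⟩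
      · rw [← hu]; exact (h _ (Finset.some_mem_insertNone.2 hl)).1
      · rw [← hv]; exact (h _ (Finset.some_mem_insertNone.2 hl)).2
    rw [h0 _ _ (fun _ => rfl) (fun _ => rfl), h0 _ _ (fun _ => rfl) (fun _ => rfl)]
    simp

theorem decoupledTerm_flipTables (w : Str a c → ℝ) (T T' : Tables a b c d) (J : Finset (Fin c))
    (r : Fin d) (g g' : Option (Fin c) → Bits a → ℤˣ) (i : ℕ) (x y : Str a c) :
    decoupledTerm w (flipTables J r g T) (flipTables J r g' T') J r i x y
      = (((∏ k ∈ Finset.insertNone J, g k (lookupPos T T J r i x k)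
            * g' k (lookupPos T' T J r i y k) : ℤˣ) : ℤ) : ℝ) * decoupledTerm w T T' J r i x y := by
  simp only [decoupledTerm, partSign_flipTables, Finset.prod_mul_distrib]
  -- Sign flips leave the hash values alone, so the cases where only one collision indicator holds
  -- are contradictory.
  split_ifs with h h' h' <;>
    first
      | exact absurd h h'
      | exact absurd h' h
      | (push_cast; ring)

theorem card_mul_splitSum (s : ℕ) (w : Str a c → ℝ) (T T' : Tables a b c d)
    (J : Finset (Fin c)) (π : PartialKey a c) (τ : PrefixKey a d)
    (ε : Option (Fin c) → Bits a → Bool) :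
    (Fintype.card (Option (Fin c) → Bits a → ℤˣ) : ℝ) * splitSum s w T T' J π τ ε
      = ∑ δ, decoupledSum s w (flipTables J τ.1 (flipSign ε δ false) T)
          (flipTables J τ.1 (flipSign ε δ true) T') J π τ := by
  have h : ∀ δ : Option (Fin c) → Bits a → ℤˣ,
      decoupledSum s w (flipTables J τ.1 (flipSign ε δ false) T)
          (flipTables J τ.1 (flipSign ε δ true) T') J π τ
        = ∑ i ∈ Finset.range s, ∑ x ∈ keysU T π τ, ∑ y ∈ keysU T π τ,
          (((∏ k ∈ Finset.insertNone J, flipSign ε δ false k (lookupPos T T J τ.1 i x k)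
            * flipSign ε δ true k (lookupPos T' T J τ.1 i y k) : ℤˣ) : ℤ) : ℝ)
              * decoupledTerm w T T' J τ.1 i x y := by
    intro δ
    simp only [← decoupledTerm_flipTables]
    rfl
  simp only [h, splitSum, Finset.mul_sum]
  symm
  rw [Finset.sum_comm]
  refine Finset.sum_congr rfl fun i _ => ?_
  rw [Finset.sum_comm]
  refine Finset.sum_congr rfl fun x _ => ?_
  rw [Finset.sum_comm]
  refine Finset.sum_congr rfl fun y _ => ?_
  rw [← Finset.sum_mul, sum_flipSign, mul_assoc]

theorem lpSum_splitSum_le {p : ℝ} (hp : 1 ≤ p) (s : ℕ) (w : Str a c → ℝ)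
    (J : Finset (Fin c)) (π : PartialKey a c) (τ : PrefixKey a d)
    (ε : Option (Fin c) → Bits a → Bool) :
    lpSum p (fun t : Tables a b c d × Tables a b c d => splitSum s w t.1 t.1 J π τ ε)
      ≤ lpSum p (fun t : Tables a b c d × Tables a b c d =>
          decoupledSum s w t.1 t.2 J π τ) := by
  have hmix : lpSum p (fun t : Tables a b c d × Tables a b c d => splitSum s w t.1 t.1 J π τ ε)
      = lpSum p (fun t : Tables a b c d × Tables a b c d => splitSum s w t.1 t.2 J π τ ε) := by
    have h := lpSum_comp_equiv p (mixEquiv J τ.1 ε)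
      (fun t : Tables a b c d × Tables a b c d => splitSum s w t.1 t.1 J π τ ε)
    simp only [mixEquiv_apply, splitSum_mixTables] at h
    exact h.symm
  have hpos : (0 : ℝ) < Fintype.card (Option (Fin c) → Bits a → ℤˣ) := by
    exact_mod_cast Fintype.card_pos
  have hflip : ∀ δ : Option (Fin c) → Bits a → ℤˣ,
      lpSum p (fun t : Tables a b c d × Tables a b c d =>
        decoupledSum s w (flipTables J τ.1 (flipSign ε δ false) t.1)
          (flipTables J τ.1 (flipSign ε δ true) t.2) J π τ)
        = lpSum p (fun t : Tables a b c d × Tables a b c d => decoupledSum s w t.1 t.2 J π τ) := by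
    intro δ
    have h := lpSum_comp_equiv p (flipEquiv J τ.1 (flipSign ε δ false) (flipSign ε δ true))
      (fun t : Tables a b c d × Tables a b c d => decoupledSum s w t.1 t.2 J π τ)
    simp only [flipEquiv_apply] at h
    exact h
  rw [hmix]
  refine le_of_mul_le_mul_left ?_ hpos
  rw [← lpSum_const_mul hp hpos.le]
  simp only [card_mul_splitSum]
  refine (lpSum_sum_le hp _ _).trans (le_of_eq ?_)
  rw [Finset.sum_congr rfl fun δ _ => hflip δ, Finset.sum_const, Finset.card_univ, nsmul_eq_mul]

theorem lpSum_distinctSum_le {p : ℝ} (hp : 1 ≤ p) (s : ℕ) (w : Str a c → ℝ)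
    (J : Finset (Fin c)) (π : PartialKey a c) (τ : PrefixKey a d) :
    lpSum p (fun t : Tables a b c d × Tables a b c d => distinctSum s w t.1 J π τ)
      ≤ 4 ^ (c + 1) * lpSum p (fun t : Tables a b c d × Tables a b c d =>
          decoupledSum s w t.1 t.2 J π τ) := by
  have hpos : (0 : ℝ) < Fintype.card (Option (Fin c) → Bits a → Bool) := by
    exact_mod_cast Fintype.card_pos
  refine le_of_mul_le_mul_left ?_ hpos
  rw [← lpSum_const_mul hp hpos.le]
  simp only [card_mul_distinctSum]
  refine (lpSum_sum_le hp _ _).trans ?_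
  rw [← nsmul_eq_mul, ← Finset.card_univ, ← Finset.sum_const]
  refine Finset.sum_le_sum fun ε _ => ?_
  rw [lpSum_const_mul hp (by positivity)]
  -- Separation costs 4 per position in `J` and 4 for the derived character, hence at most `4 ^ (c +
  -- 1)`.
  have hJ : J.card ≤ c := by simpa using J.card_le_univ
  gcongr
  · exact lpSum_nonneg _ _
  · norm_num
  · exact lpSum_splitSum_le hp s w J π τ ε

end Decoupling

/-! ### Splitting pairs by common partial key and common prefix -/

section Decomposition

variable {a b c d : ℕ}

/-- The partial key on the positions in `I` that is contained in `x`. -/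
def restrictKey (I : Finset (Fin c)) (x : Str a c) : PartialKey a c := ⟨I, fun l => x l⟩

/-- The prefix of length `r` of `z`. -/
def takePrefix (r : Fin d) (z : Str a d) : PrefixKey a d :=
  ⟨r, fun k => z (Fin.castLE r.isLt.le k)⟩

theorem PartialKey.sub_iff (I : Finset (Fin c)) (α : I → Bits a) (x : Str a c) :
    PartialKey.Sub ⟨I, α⟩ x ↔ α = fun l : I => x l :=
  ⟨fun h => funext fun l => (h l).symm, fun h l => by rw [h]⟩

theorem PrefixKey.sub_iff (r : Fin d) (α : Fin (r : ℕ) → Bits a) (z : Str a d) :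
    PrefixKey.Sub ⟨r, α⟩ z ↔ α = fun k => z (Fin.castLE r.isLt.le k) :=
  ⟨fun h => funext fun k => (h k).symm, fun h k => by rw [h]⟩

open Classical in
theorem sum_partialKey_sub (x : Str a c) :
    ∑ π : PartialKey a c, (if π.Sub x then (1 : ℝ) else 0) = 2 ^ c := by
  rw [Fintype.sum_sigma]
  simp [PartialKey.sub_iff]

open Classical in
theorem sum_prefixKey_sub (z : Str a d) :
    ∑ τ : PrefixKey a d, (if τ.Sub z then (1 : ℝ) else 0) = d := by
  rw [Fintype.sum_sigma]
  simp [PrefixKey.sub_iff]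

-- The only contributing `π` is the restriction of `x` to the agreement set of `x` and `y`.
open Classical in
theorem sum_partialKey_agree (x y : Str a c) :
    ∑ π : PartialKey a c,
      (if π.Sub x ∧ π.Sub y ∧ ∀ l ∈ π.1ᶜ, x l ≠ y l then (1 : ℝ) else 0) = 1 := by
  rw [Finset.sum_eq_single_of_mem (restrictKey (Finset.univ.filter fun l => x l = y l) x)
    (Finset.mem_univ _)]
  · refine if_pos ⟨fun l => rfl, fun l => ?_, fun l hl => ?_⟩
    · have := l.2
      simp only [restrictKey, Finset.mem_filter] at this
      exact this.2.symm
    · simpa [restrictKey] using hl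
  · rintro ⟨I, α⟩ - hne
    refine if_neg fun ⟨hx, hy, h⟩ => hne ?_
    have hI : I = Finset.univ.filter fun l => x l = y l := by
      ext l
      simp only [Finset.mem_filter, Finset.mem_univ, true_and]
      constructor
      · intro hl
        exact (hx ⟨l, hl⟩).trans (hy ⟨l, hl⟩).symm
      · intro hl
        by_contra hl'
        exact h l (Finset.mem_compl.2 hl') hl
    rw [PartialKey.sub_iff] at hx
    subst hx
    subst hI
    rfl

-- The only contributing `τ` is the longest common prefix, cut at the first disagreement; it is
-- proper because `z ≠ z'`.
open Classical in
theorem sum_prefixKey_agree (z z' : Str a d) :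
    ∑ τ : PrefixKey a d,
      (if τ.Sub z ∧ τ.Sub z' ∧ z τ.1 ≠ z' τ.1 then (1 : ℝ) else 0)
        = if z ≠ z' then 1 else 0 := by
  by_cases hz : z = z'
  · simp [hz]
  rw [if_pos hz]
  obtain ⟨r, hr, hmin⟩ := WellFounded.has_min (wellFounded_lt (α := Fin d)) {k | z k ≠ z' k}
    (Function.ne_iff.1 hz)
  have hlt : ∀ k < r, z k = z' k := fun k hk => by
    by_contra h
    exact hmin k h hk
  rw [Finset.sum_eq_single_of_mem (takePrefix r z) (Finset.mem_univ _)]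
  · exact if_pos ⟨fun k => rfl, fun k => (hlt _ (Fin.lt_def.2 k.isLt)).symm, hr⟩
  · rintro ⟨r', α⟩ - hne
    refine if_neg fun ⟨hx, hy, h⟩ => hne ?_
    have h1 : r' = r := by
      refine le_antisymm (not_lt.1 fun hlt' => ?_) (not_lt.1 fun hlt' => h (hlt r' hlt'))
      exact hr ((hx ⟨r, hlt'⟩).trans (hy ⟨r, hlt'⟩).symm)
    rw [PrefixKey.sub_iff] at hx
    subst h1
    subst hx
    rfl

/-- The summand of `collisionSum`, without the condition on the derived characters. -/
noncomputable def collisionTerm (w : Str a c → ℝ) (T : Tables a b c d) (i : ℕ) (x y : Str a c) :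
    ℝ :=
  (((mixedSign T i x : ℤ) : ℝ) * ((mixedSign T i y : ℤ) : ℝ))
    * (if mixedHash T i x = mixedHash T i y then 1 else 0) * (w x * w y)

theorem sum_mul_sum_eq_sum_prod {P Q : Type*} [Fintype P] [Fintype Q] (f : P → ℝ) (g : Q → ℝ) :
    (∑ x, f x) * ∑ y, g y = ∑ q : P × Q, f q.1 * g q.2 := by
  rw [Fintype.sum_mul_sum, Fintype.sum_prod_type]

theorem indicator_mul_eq (p p' q q' m n : Prop) [Decidable (p ∧ q)] [Decidable (p' ∧ q')]
    [Decidable (n ∧ m)] [Decidable (p ∧ p' ∧ m)] [Decidable (q ∧ q' ∧ n)] (t : ℝ) :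
    (if p ∧ q then if p' ∧ q' then (if n ∧ m then 1 else 0) * t else 0 else 0)
      = ((if p ∧ p' ∧ m then 1 else 0) * (if q ∧ q' ∧ n then 1 else 0)) * t := by
  by_cases p <;> by_cases p' <;> by_cases q <;> by_cases q' <;> by_cases m <;> by_cases n <;>
    simp [*]

open Classical in
theorem distinctSum_eq (s : ℕ) (w : Str a c → ℝ) (T : Tables a b c d)
    (J : Finset (Fin c)) (π : PartialKey a c) (τ : PrefixKey a d) :
    distinctSum s w T J π τ = ∑ i ∈ Finset.range s, ∑ x, ∑ y,
      ((if π.Sub x ∧ π.Sub y ∧ ∀ l ∈ J, x l ≠ y l then 1 else 0)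
        * (if τ.Sub (derived T x) ∧ τ.Sub (derived T y) ∧ derived T x τ.1 ≠ derived T y τ.1
            then 1 else 0)) * collisionTerm w T i x y := by
  unfold distinctSum keysU
  have hite : ∀ (P : Prop) [Decidable P] (f : Str a c → ℝ),
      (if P then ∑ y, f y else 0) = ∑ y, if P then f y else 0 := by
    intro P _ f; split_ifs <;> simp
  refine Finset.sum_congr rfl fun i _ => ?_
  rw [Finset.sum_filter]
  refine Finset.sum_congr rfl fun x _ => ?_
  rw [Finset.sum_filter, hite]
  refine Finset.sum_congr rfl fun y _ => ?_
  have hterm : decoupledTerm w T T J τ.1 i x y = collisionTerm w T i x y := by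
    simp only [decoupledTerm, collisionTerm, partSign_self, partHash_self]
  have hdist : (∀ k ∈ Finset.insertNone J, lookupPos T T J τ.1 i x k ≠ lookupPos T T J τ.1 i y k)
      ↔ derived T x τ.1 ≠ derived T y τ.1 ∧ ∀ l ∈ J, x l ≠ y l := by
    rw [Finset.forall_mem_insertNone, lookupPos_self_none, lookupPos_self_none, Ne,
      add_left_inj]
    rfl
  rw [hterm]
  simp only [hdist]
  exact indicator_mul_eq _ _ _ _ _ _ _

theorem collisionSum_eq (s : ℕ) (w : Str a c → ℝ) (T : Tables a b c d) :
    collisionSum s w T = ∑ i ∈ Finset.range s, ∑ x, ∑ y,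
      (if derived T x ≠ derived T y then 1 else 0) * collisionTerm w T i x y := by
  simp only [collisionSum, collisionTerm, mul_assoc]

theorem collisionSum_eq_sum_partialKey (s : ℕ) (w : Str a c → ℝ) (T : Tables a b c d) :
    collisionSum s w T
      = ∑ q : PartialKey a c × PrefixKey a d, distinctSum s w T q.1.1ᶜ q.1 q.2 := by
  classical
  simp only [collisionSum_eq, distinctSum_eq]
  symm
  rw [Finset.sum_comm]
  refine Finset.sum_congr rfl fun i _ => ?_
  rw [Finset.sum_comm]
  refine Finset.sum_congr rfl fun x _ => ?_
  rw [Finset.sum_comm]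
  refine Finset.sum_congr rfl fun y _ => ?_
  rw [← Finset.sum_mul]
  congr 1
  have h := congrArg₂ (· * ·) (sum_partialKey_agree x y)
    (sum_prefixKey_agree (derived T x) (derived T y))
  simp only [one_mul] at h
  rw [sum_mul_sum_eq_sum_prod] at h
  exact h

/-- With `J = ∅` only the derived characters are compared. The key `x₀` is a dummy, as its
restriction to `∅` is the empty partial key. -/
theorem collisionSum_eq_sum_prefixKey (s : ℕ) (w : Str a c → ℝ) (T : Tables a b c d)
    (x₀ : Str a c) :
    collisionSum s w T = ∑ τ : PrefixKey a d, distinctSum s w T ∅ (restrictKey ∅ x₀) τ := by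
  classical
  simp only [collisionSum_eq, distinctSum_eq]
  symm
  rw [Finset.sum_comm]
  refine Finset.sum_congr rfl fun i _ => ?_
  rw [Finset.sum_comm]
  refine Finset.sum_congr rfl fun x _ => ?_
  rw [Finset.sum_comm]
  refine Finset.sum_congr rfl fun y _ => ?_
  have h : ∀ z : Str a c, (restrictKey ∅ x₀).Sub z := fun z l => absurd l.2 (by simp [restrictKey])
  rw [← Finset.sum_mul, ← sum_prefixKey_agree]
  simp [h]

theorem sum_keysU_sq (w : Str a c → ℝ) (T : Tables a b c d) :
    ∑ π : PartialKey a c, ∑ τ : PrefixKey a d, ∑ x ∈ keysU T π τ, w x ^ 2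
      = d * 2 ^ c * ∑ x, w x ^ 2 := by
  classical
  have h : ∀ (π : PartialKey a c) (τ : PrefixKey a d), ∑ x ∈ keysU T π τ, w x ^ 2
      = ∑ x, ((if π.Sub x then 1 else 0) * (if τ.Sub (derived T x) then 1 else 0)) * w x ^ 2 := by
    intro π τ
    unfold keysU
    rw [Finset.sum_filter]
    refine Finset.sum_congr rfl fun x _ => ?_
    split_ifs <;> first | tauto | simp
  simp only [h]
  rw [← Fintype.sum_prod_type', Finset.sum_comm, Finset.mul_sum]
  refine Finset.sum_congr rfl fun x _ => ?_
  rw [← Finset.sum_mul]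
  congr 1
  have h := congrArg₂ (· * ·) (sum_partialKey_sub x) (sum_prefixKey_sub (derived T x))
  rw [sum_mul_sum_eq_sum_prod, mul_comm (2 ^ c : ℝ)] at h
  exact h

end Decomposition

/-! ### Passage to the probability space, and the theorem -/

/-- Independence makes the pair uniform on `E × E`. The factor does not depend on `X`, so it cancels
from the inequalities. -/
theorem pNorm_eq_lpSum {E Ω : Type*} [MeasurableSpace E] [Fintype E] [DiscreteMeasurableSpace E]
    [Nonempty E] [MeasurableSpace Ω] {μ : Measure Ω} [IsProbabilityMeasure μ] {T T' : Ω → E}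
    (hT : HasLaw T (uniformOn Set.univ) μ) (hT' : HasLaw T' (uniformOn Set.univ) μ)
    (hind : IndepFun T T' μ) (p : ℝ) (X : E × E → ℝ) :
    pNorm μ p (fun ω => X (T ω, T' ω))
      = ((Fintype.card E : ℝ)⁻¹ * (Fintype.card E : ℝ)⁻¹) ^ (1 / p) * lpSum p X := by
  have hmap : μ.map (fun ω => (T ω, T' ω))
      = (uniformOn (Set.univ : Set E)).prod (uniformOn Set.univ) := by
    rw [hind.map_prod_eq_prod_map_map hT.aemeasurable hT'.aemeasurable, hT.map_eq, hT'.map_eq]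
  have hpoint : ∀ t : E, (uniformOn (Set.univ : Set E)).real {t} = (Fintype.card E : ℝ)⁻¹ := by
    intro t
    simp [measureReal_def, uniformOn_univ]
  have hint : ∫ ω, |X (T ω, T' ω)| ^ p ∂μ
      = ((Fintype.card E : ℝ)⁻¹ * (Fintype.card E : ℝ)⁻¹) * ∑ t, |X t| ^ p := by
    rw [← integral_map (φ := fun ω => (T ω, T' ω)) (f := fun t => |X t| ^ p)
      (hT.aemeasurable.prodMk hT'.aemeasurable)
      Measurable.of_discrete.aestronglyMeasurable, hmap, integral_fintype .of_finite, Finset.mul_sum]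
    refine Finset.sum_congr rfl fun t _ => ?_
    rw [← Set.singleton_prod_singleton, measureReal_prod_prod, hpoint, hpoint, smul_eq_mul]
  rw [pNorm, hint, Real.mul_rpow (by positivity) (by positivity), lpSum]

theorem mainTheorem5 (a b c d s : ℕ) (hs : s ≤ 2 ^ a)
    {Ω : Type*} [MeasurableSpace Ω] (μ : Measure Ω) [IsProbabilityMeasure μ]
    (T T' : Ω → Tables a b c d)
    (hT : HasLaw T (uniformOn Set.univ) μ)
    (hT' : HasLaw T' (uniformOn Set.univ) μ)
    (hind : IndepFun T T' μ)
    (p : ℝ) (hp : 1 ≤ p) (w : Str a c → ℝ) :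
    (pNorm μ p (fun ω => collisionSum s w (T ω))
      ≤ ∑ π : PartialKey a c, ∑ τ : PrefixKey a d,
          (4 : ℝ) ^ (c + 1) * pNorm μ p (fun ω => decoupledSum s w (T ω) (T' ω) π.1ᶜ π τ)) ∧
    (pNorm μ p (fun ω => collisionSum s w (T ω))
      ≤ ∑ π : PartialKey a c, ∑ τ : PrefixKey a d,
          (4 : ℝ) ^ (c + 1) * pNorm μ p (fun ω => decoupledSum s w (T ω) (T' ω) π.1 π τ)) ∧
    (∀ ω, ∑ π : PartialKey a c, ∑ τ : PrefixKey a d, ∑ x ∈ keysU (T ω) π τ, w x ^ 2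
      ≤ d * 2 ^ c * ∑ x, w x ^ 2) := by
  have hnorm := pNorm_eq_lpSum hT hT' hind p
  have hK : 0 ≤ ((Fintype.card (Tables a b c d) : ℝ)⁻¹ * (Fintype.card (Tables a b c d) : ℝ)⁻¹)
      ^ (1 / p) := by positivity
  have hcoll := hnorm fun t => collisionSum s w t.1
  have hdec : ∀ J π τ, _ := fun J π τ => hnorm fun t => decoupledSum s w t.1 t.2 J π τ
  simp only at hcoll hdec
  refine ⟨?_, ?_, fun ω => (sum_keysU_sq w (T ω)).le⟩
  · simp only [hcoll, hdec, mul_left_comm _ (_ ^ (1 / p)), ← Finset.mul_sum]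
    refine mul_le_mul_of_nonneg_left ?_ hK
    simp only [collisionSum_eq_sum_partialKey]
    refine (lpSum_sum_le hp _ _).trans ?_
    rw [Fintype.sum_prod_type]
    simp only [Finset.mul_sum]
    exact Finset.sum_le_sum fun π _ => Finset.sum_le_sum fun τ _ =>
      lpSum_distinctSum_le hp s w π.1ᶜ π τ
  · simp only [hcoll, hdec, mul_left_comm _ (_ ^ (1 / p)), ← Finset.mul_sum]
    refine mul_le_mul_of_nonneg_left ?_ hK
    simp only [collisionSum_eq_sum_prefixKey s w _ 0]
    refine (lpSum_sum_le hp _ _).trans ?_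
    simp only [Finset.mul_sum]
    refine (Finset.sum_le_sum fun τ _ =>
      lpSum_distinctSum_le hp s w ∅ (restrictKey ∅ 0) τ).trans ?_
    -- The bound obtained is the summand at the empty partial key, where `J = I_π = ∅`.
    exact Finset.single_le_sum
      (f := fun π : PartialKey a c => ∑ τ : PrefixKey a d, (4 : ℝ) ^ (c + 1) *
        lpSum p fun t : Tables a b c d × Tables a b c d => decoupledSum s w t.1 t.2 π.1 π τ)
      (fun π _ => Finset.sum_nonneg fun τ _ => mul_nonneg (by positivity) (lpSum_nonneg _ _))
      (Finset.mem_univ (restrictKey ∅ 0))
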